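/- Let $k$ be an algebraically closed field, let $d,n$ be positive integers, and let $\mathcal M$ be a loop-free matroid of rank $d$ on $\{1,\dots,n\}$ that has no pairs of distinct parallel elements (i.e. no two-element circuits). Let $X\subset \mathbb A^n_k=\operatorname{Spec} k[x_1,\dots,x_n]$ be a $d$-dimensional linear subspace of combinatorial type $\mathcal M$, i.e. such that a set $I\subset\{1,\dots,n\}$ is independent in $\mathcal M$ if and only if the restrictions $x_i|_X$, $i\in I$, are linearly independent. Let $F$ be the scheme-theoretic intersection of $X$ with the hypersurface $x_1\cdots x_n=1$, regarded as a closed subscheme of the torus $\mathbb G_{m,k}^n=\operatorname{Spec} k[x_1^{\pm1},\dots,x_n^{\pm1}]$, and let $I_F$ be the ideal of $F$ in $k[x_1^{\pm1},\dots,x_n^{\pm1}]$. For $w\in\mathbb R^n$ and a Laurent polynomial $f=\sum_u a_u x^u$, let $\operatorname{in}_w f$ be the sum of the terms $a_u x^u$ with $a_u\neq 0$ for which $\langle w,u\rangle$ is minimal, and let $\operatorname{in}_w F\subset\mathbb G_{m,k}^n$ be the closed subscheme defined by the ideal generated by $\{\operatorname{in}_w f : f\in I_F\}$. Then for every $w\in\mathbb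 R^n$, the initial degeneration $\operatorname{in}_w F$ is irreducible whenever it is nonempty; that is, $\operatorname{in}_w F$ is either empty or an irreducible topological space. -/

import Mathlib

universe u

noncomputable section

namespace MilnorArrangement

/-- Two elements of a matroid are parallel if they are nonloops that are equal or form a
two-element circuit. -/
def Parallel {α : Type*} (M : Matroid α) (i j : α) : Prop :=
  M.IsNonloop i ∧ (i = j ∨ M.IsCircuit {i, j})

/-- The `k`-points of the Grassmannian: the `d`-dimensional linear subspaces of `k ^ n`. -/
def Gr (k : Type u) [Field k] (d n : ℕ) : Set (Submodule k (Fin n → k)) :=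
  {A | Module.finrank k A = d}

/-- The restriction to the subspace `A` of the `i`-th coordinate function. -/
def coord {k : Type u} [Field k] {n : ℕ} (A : Submodule k (Fin n → k)) (i : Fin n) :
    A →ₗ[k] k :=
  (LinearMap.proj i : (Fin n → k) →ₗ[k] k).domRestrict A

/-- The `k`-points of the realization space of `M`: the `d`-dimensional linear subspaces of
`k ^ n` with combinatorial type `M`. -/
def GrMatroid (k : Type u) [Field k] (d : ℕ) {n : ℕ} (M : Matroid (Fin n)) :
    Set (Submodule k (Fin n → k)) :=
  {A | A ∈ Gr k d n ∧ ∀ I : Set (Fin n), M.Indep I ↔ LinearIndepOn k (coord A) I}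

/-- The ideal of `k[x₁, …, xₙ]` that defines the linear subspace `X_A` of affine space: it is
generated by the linear forms that vanish on `A`. -/
def linearIdeal {k : Type u} [Field k] {n : ℕ} (A : Submodule k (Fin n → k)) :
    Ideal (MvPolynomial (Fin n) k) :=
  Ideal.span {L | ∃ a : Fin n → k, (∀ v ∈ A, ∑ i, a i * v i = 0) ∧
    L = ∑ i, MvPolynomial.C (a i) * MvPolynomial.X i}

/-- The ideal of `k[x₁, …, xₙ]` that defines `F_A`, the scheme-theoretic intersection of `X_A`
with the hypersurface `x₁ ⋯ xₙ = 1`. -/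
def milnorIdeal {k : Type u} [Field k] {n : ℕ} (A : Submodule k (Fin n → k)) :
    Ideal (MvPolynomial (Fin n) k) :=
  linearIdeal A ⊔ Ideal.span {(∏ i, MvPolynomial.X i) - 1}

/-- The Laurent polynomial ring `k[x₁^±1, …, xₙ^±1]`. -/
abbrev Laurent (k : Type u) [Field k] (n : ℕ) : Type u :=
  AddMonoidAlgebra k (Fin n → ℤ)

/-- The inclusion of polynomials into Laurent polynomials. -/
def toLaurent (k : Type u) [Field k] (n : ℕ) :
    MvPolynomial (Fin n) k →ₐ[k] Laurent k n :=
  MvPolynomial.aeval fun i => AddMonoidAlgebra.single (Pi.single i 1) 1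

/-- The ideal that defines `F_A` as a closed subscheme of the algebraic torus. -/
def milnorTorusIdeal {k : Type u} [Field k] {n : ℕ} (A : Submodule k (Fin n → k)) :
    Ideal (Laurent k n) :=
  (milnorIdeal A).map (toLaurent k n)

/-- The `w`-weight of the monomial with exponent `u`. -/
def weight {n : ℕ} (w : Fin n → ℝ) (u : Fin n → ℤ) : ℝ :=
  ∑ i, w i * (u i : ℝ)

open Classical in
/-- The initial form `in_w f`: the sum of the terms of `f` of minimal `w`-weight. -/
def initialForm {k : Type u} [Field k] {n : ℕ} (w : Fin n → ℝ) (f : Laurent k n) :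
    Laurent k n :=
  AddMonoidAlgebra.ofCoeff
    (f.coeff.filter fun u => ∀ v ∈ f.coeff.support, weight w u ≤ weight w v)

/-- The ideal generated by the initial forms of the elements of `I`. -/
def initialIdeal {k : Type u} [Field k] {n : ℕ} (w : Fin n → ℝ) (I : Ideal (Laurent k n)) :
    Ideal (Laurent k n) :=
  Ideal.span (initialForm w '' (I : Set (Laurent k n)))

/-- The initial degeneration `in_w X` of the closed subscheme `X` of the torus defined by `I`. -/
def initialDegeneration {k : Type u} [Field k] {n : ℕ} (w : Fin n → ℝ)
    (I : Ideal (Laurent k n)) : AlgebraicGeometry.Scheme.{u} :=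
  AlgebraicGeometry.Spec (CommRingCat.of (Laurent k n ⧸ initialIdeal w I))

end MilnorArrangement

end

/-! The initial ideal of `F` is shown to be either the unit ideal or prime. If `∑ w i ≠ 0`, the
initial form of `x₁ ⋯ xₙ - 1` is a unit. Otherwise take a base of maximal `w`-weight and expand `x_i
= ∑ c i b x_b` in it. An exchange argument gives `w i ≤ w b` whenever `c i b ≠ 0`, so the initial
relation is `x_i = ℓ_i`, where `ℓ_i = leadForm c w i` collects the terms of weight `w i`. If some
`ℓ_i` is zero, the unit `x_i` lies in the initial ideal.

If no `ℓ_i` vanishes, put `h = ∏ ℓ_i`. The initial ideal is the preimage of `(h - 1)` under `x_i ↦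
ℓ_i` into `k[x][1/h]` (`isPrime_initialIdeal`). That no further initial forms occur is seen from the
deformation `x_i ↦ ∑ c i b x_b t^(w b)` into Hahn series: it satisfies the linear relations, has
leading terms `ℓ_i t^(w i)`, and turns `∏ x_i - 1` into a series with leading coefficient `h - 1`,
which therefore divides the image of every initial form.

It remains that `h - 1` is irreducible (`irreducible_X_mul_sub_one`). A base element `b` of globally
maximal weight gives a factor `x_b` of `h`, and the absence of parallel elements makes it a simple
factor. In a nontrivial factorization of `h - 1`, both factors become constant at `x_b = 0`, so
`x_b` divides both top-degree components, and `x_b²` would divide `h`. -/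

namespace MilnorArrangement

/-! ### Irreducibility of `X b * g - 1` for homogeneous `X b * g` -/

section Irreducible

open MvPolynomial

variable {σ : Type*} {k : Type u} [Field k]

/-- The homomorphism `p ↦ p(T x)`, whose coefficients are the homogeneous components of `p`. -/
noncomputable def dilate (σ : Type*) (k : Type u) [Field k] :
    MvPolynomial σ k →ₐ[k] Polynomial (MvPolynomial σ k) :=
  aeval fun i => Polynomial.C (X i) * Polynomial.X

/-- The homomorphism that sets the variable `b` to zero. -/
noncomputable def killVar (k : Type u) [Field k] (b : σ) [DecidableEq σ] :
    MvPolynomial σ k →ₐ[k] MvPolynomial σ k :=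
  aeval (Function.update X b 0)

theorem dilate_of_isHomogeneous {p : MvPolynomial σ k} {n : ℕ} (hp : p.IsHomogeneous n) :
    dilate σ k p = Polynomial.C p * Polynomial.X ^ n := by
  have hmon : ∀ (d : σ →₀ ℕ) (r : k), dilate σ k (monomial d r) =
      Polynomial.C (monomial d r) * Polynomial.X ^ d.degree := by
    intro d r
    rw [dilate, aeval_monomial, monomial_eq, map_mul, mul_assoc, Finsupp.prod, Finsupp.prod]
    congr 1
    simp only [mul_pow, Finset.prod_mul_distrib, map_prod, map_pow, Finsupp.degree,
      Finset.prod_pow_eq_pow_sum]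
    rfl
  conv_lhs => rw [p.as_sum]
  conv_rhs => rw [p.as_sum]
  rw [map_sum, map_sum, Finset.sum_mul]
  refine Finset.sum_congr rfl fun d hd => ?_
  rw [hmon, Finsupp.degree_eq_weight_one, ← hp (mem_support_iff.1 hd)]
  rfl

theorem eval_one_dilate (p : MvPolynomial σ k) : (dilate σ k p).eval 1 = p := by
  have : ((Polynomial.aeval (1 : MvPolynomial σ k)).restrictScalars k).comp (dilate σ k) =
      AlgHom.id k _ := by
    ext i; simp [dilate]
  simpa [Polynomial.aeval_def] using congr($this p)

theorem eval_zero_dilate (p : MvPolynomial σ k) :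
    (dilate σ k p).eval 0 = C (constantCoeff p) := by
  have : ((Polynomial.aeval (0 : MvPolynomial σ k)).restrictScalars k).comp (dilate σ k) =
      (Algebra.ofId k (MvPolynomial σ k)).comp (aeval fun _ => (0 : k)) := by
    ext i; simp [dilate]
  have h2 := congr($this p)
  simpa [Polynomial.aeval_def, Algebra.ofId_apply, algebraMap_eq] using h2

/-- A polynomial in `T` of degree zero takes the same value at `T = 1` and at `T = 0`. -/
theorem eq_C_of_natDegree_dilate_eq_zero {p : MvPolynomial σ k}
    (hp : (dilate σ k p).natDegree = 0) : p = C (constantCoeff p) := by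
  rw [← eval_zero_dilate]
  conv_lhs => rw [← eval_one_dilate p]
  rw [Polynomial.eq_C_of_natDegree_eq_zero hp]
  simp

theorem X_dvd_sub_killVar [DecidableEq σ] (b : σ) (p : MvPolynomial σ k) : X b ∣ p - killVar k b p := by
  rw [← Ideal.mem_span_singleton, ← Ideal.Quotient.eq]
  have : (Ideal.Quotient.mkₐ k (Ideal.span {(X b : MvPolynomial σ k)})).comp (killVar k b) =
      Ideal.Quotient.mkₐ k _ := by
    ext i
    rcases eq_or_ne i b with rfl | hi
    · simp [killVar]
    · simp [killVar, hi]
  exact congr($this p).symm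

theorem map_killVar_dilate [DecidableEq σ] (b : σ) (p : MvPolynomial σ k) :
    (dilate σ k p).map (killVar k b : MvPolynomial σ k →+* MvPolynomial σ k) =
      dilate σ k (killVar k b p) := by
  have : (Polynomial.mapAlgHom (killVar k b)).comp (dilate σ k) =
      (dilate σ k).comp (killVar k b) := by
    ext i : 1
    rcases eq_or_ne i b with rfl | hi
    · simp [killVar, dilate]
    · simp [killVar, dilate, hi]
  exact congr($this p)

/-- The leading coefficient in `T` is the top homogeneous component of `p`. If `p` becomes constant
modulo `X b`, every component of positive degree vanishes modulo `X b`. -/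
theorem X_dvd_leadingCoeff_dilate [DecidableEq σ] {b : σ} {p : MvPolynomial σ k}
    (hp : IsUnit (killVar k b p)) (hdeg : (dilate σ k p).natDegree ≠ 0) : X b ∣ (dilate σ k p).leadingCoeff := by
  obtain ⟨r, -, hr⟩ := MvPolynomial.isUnit_iff_eq_C_of_isReduced.1 hp
  have h := congr(Polynomial.coeff $(map_killVar_dilate b p) (dilate σ k p).natDegree)
  rw [hr, show dilate σ k (C r) = Polynomial.C (C r) from (dilate σ k).commutes r,
    Polynomial.coeff_C_of_ne_zero hdeg, Polynomial.coeff_map] at h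
  have h2 := X_dvd_sub_killVar b (dilate σ k p).leadingCoeff
  rwa [show killVar k b (dilate σ k p).leadingCoeff = 0 from h, sub_zero] at h2

/-- Setting `X b = 0` turns the polynomial into `-1`, so both factors reduce to units there, while
their top components multiply to `X b * g`. -/
theorem irreducible_X_mul_sub_one {b : σ} {g : MvPolynomial σ k} (hg : ¬ X b ∣ g) {n : ℕ}
    (hn : n ≠ 0) (hh : (X b * g).IsHomogeneous n) : Irreducible (X b * g - 1) := by
  classical
  have hg0 : g ≠ 0 := by rintro rfl; exact hg (dvd_zero _)
  have hne : X b * g ≠ 0 := mul_ne_zero (X_ne_zero b) hg0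
  have hdil : dilate σ k (X b * g - 1) =
      Polynomial.C (X b * g) * Polynomial.X ^ n - Polynomial.C 1 := by
    rw [map_sub, dilate_of_isHomogeneous hh, map_one, Polynomial.C_1]
  have hlead : (dilate σ k (X b * g - 1)).leadingCoeff = X b * g := by
    rw [hdil, Polynomial.leadingCoeff_sub_of_degree_lt, Polynomial.leadingCoeff_C_mul_X_pow]
    rw [Polynomial.degree_C_mul_X_pow n hne]
    exact Polynomial.degree_C_le.trans_lt (by exact_mod_cast Nat.pos_of_ne_zero hn)
  have hkill : killVar k b (X b * g - 1) = -1 := by simp [killVar]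
  refine ⟨fun hu => ?_, fun p q hpq => ?_⟩
  · obtain ⟨r, -, hr⟩ := MvPolynomial.isUnit_iff_eq_C_of_isReduced.1 hu
    have hC : dilate σ k (X b * g - 1) = Polynomial.C (C r) := by
      rw [hr]; exact (dilate σ k).commutes r
    have h2 := congr(Polynomial.coeff $(hC.symm.trans hdil) n)
    rw [Polynomial.coeff_C_of_ne_zero hn, Polynomial.coeff_sub, Polynomial.coeff_C_mul_X_pow,
      if_pos rfl, Polynomial.coeff_C_of_ne_zero hn, sub_zero] at h2
    exact hne h2.symm
  · have hpq0 : p * q ≠ 0 := fun h0 => by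
      rw [← hpq] at h0
      rw [h0, map_zero] at hkill
      exact one_ne_zero (neg_eq_zero.1 hkill.symm)
    have hunit : IsUnit (killVar k b p * killVar k b q) := by
      rw [← map_mul, ← hpq, hkill]; exact isUnit_one.neg
    have key : ∀ r : MvPolynomial σ k, r ≠ 0 → (dilate σ k r).natDegree = 0 → IsUnit r := by
      intro r hr hd
      rw [eq_C_of_natDegree_dilate_eq_zero hd] at hr ⊢
      exact (IsUnit.mk0 _ fun h => hr (by rw [h, C_0])).map C
    by_contra! hcon
    have hp : (dilate σ k p).natDegree ≠ 0 := fun h => hcon.1 (key p (left_ne_zero_of_mul hpq0) h)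
    have hq : (dilate σ k q).natDegree ≠ 0 := fun h => hcon.2 (key q (right_ne_zero_of_mul hpq0) h)
    -- If neither factor is constant, `X b * X b` divides the top component `X b * g`.
    have h1 := mul_dvd_mul (X_dvd_leadingCoeff_dilate (isUnit_of_mul_isUnit_left hunit) hp)
      (X_dvd_leadingCoeff_dilate (isUnit_of_mul_isUnit_right hunit) hq)
    rw [← Polynomial.leadingCoeff_mul, ← map_mul, ← hpq, hlead] at h1
    exact hg ((mul_dvd_mul_iff_left (X_ne_zero b)).1 h1)

end Irreducible

/-! ### Bases of maximal weight -/

section Basis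

variable {k : Type u} [Field k] {n : ℕ}

/-- A base of maximal `w`-weight, with the expansions of the coordinate functions in it. -/
theorem exists_maxWeight_base {M : Matroid (Fin n)}
    {A : Submodule k (Fin n → k)} (hA : ∀ I : Set (Fin n), M.Indep I ↔ LinearIndepOn k (coord A) I)
    (w : Fin n → ℝ) :
    ∃ (B : Set (Fin n)) (c : Fin n → Fin n → k),
      (∀ b ∈ B, c b = Pi.single b 1) ∧
      (∀ i b, c i b ≠ 0 → b ∈ B ∧ w i ≤ w b) ∧
      (∀ i, coord A i = ∑ b, c i b • coord A b) ∧
      ∀ a : Fin n → k, ∑ i, a i • coord A i = 0 → ∀ b, ∑ i, a i * c i b = 0 := by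
  classical
  obtain ⟨B, hB, hmax⟩ := Set.exists_max_image {B | M.IsBase B} (fun B => ∑ i, B.indicator w i)
    (Set.toFinite _) M.exists_isBase
  have hBi : LinearIndepOn k (coord A) B := (hA B).1 hB.indep
  have hex : ∀ i, ∃ l ∈ Finsupp.supported k k B,
      Finsupp.linearCombination k (coord A) l = coord A i ∧
        (i ∈ B → l = Finsupp.single i 1) := by
    intro i
    by_cases hi : i ∈ B
    · exact ⟨Finsupp.single i 1, Finsupp.single_mem_supported k _ hi, by simp, fun _ => rfl⟩
    · have hspan : coord A i ∈ Submodule.span k (coord A '' B) := by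
        by_contra hns
        have hins := (hA _).2 (hBi.insert hns)
        exact hi (hB.eq_of_subset_indep hins (Set.subset_insert _ _) ▸ Set.mem_insert i B)
      obtain ⟨l, hl, hl2⟩ := (Finsupp.mem_span_image_iff_linearCombination k).1 hspan
      exact ⟨l, hl, hl2, fun h => absurd h hi⟩
  choose l hlB hl hlsingle using hex
  have hinj := linearIndepOn_iff.1 hBi
  refine ⟨B, fun i b => l i b, fun b hb => ?_, fun i b hib => ?_, fun i => ?_, fun a ha b => ?_⟩
  · ext b'
    simp [hlsingle b hb, Finsupp.single_apply, Pi.single_apply, eq_comm]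
  · change l i b ≠ 0 at hib
    have hbB : b ∈ B := (Finsupp.mem_supported k _).1 (hlB i) (Finsupp.mem_support_iff.2 hib)
    refine ⟨hbB, ?_⟩
    by_cases hi : i ∈ B
    · rw [hlsingle i hi, Finsupp.single_apply] at hib
      have : i = b := by by_contra h; simp [h] at hib
      rw [this]
    -- The expansion in `B` is unique and involves `b`, so `coord A i` is not in the span of the
    -- others and `b` can be exchanged for `i`.
    · have hns : coord A i ∉ Submodule.span k (coord A '' (B \ {b})) := by
        intro hs
        obtain ⟨m, hm, hm2⟩ := (Finsupp.mem_span_image_iff_linearCombination k).1 hs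
        have h0 := hinj (l i - m)
          (Submodule.sub_mem _ (hlB i) (Finsupp.supported_mono Set.sdiff_subset hm))
          (by rw [map_sub, hl, hm2, sub_self])
        apply hib
        rw [sub_eq_zero.1 h0]
        exact Finsupp.notMem_support_iff.1 fun h => ((Finsupp.mem_supported k _).1 hm h).2 rfl
      have hind := (hA _).2 ((hBi.mono Set.sdiff_subset).insert hns)
      -- The exchange changes the total weight by `w i - w b`, which maximality forces to be at most
      -- zero.
      have hle := hmax _ (hB.exchange_isBase_of_indep hi hind)
      have hsum : ∑ j, (insert i (B \ {b})).indicator w j =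
          ∑ j, (B.indicator w j + (if j = i then w i else 0) - (if j = b then w b else 0)) := by
        refine Finset.sum_congr rfl fun j _ => ?_
        rcases eq_or_ne j i with rfl | hji
        · have : j ≠ b := fun h => hi (h ▸ hbB)
          simp [hi, this]
        · rcases eq_or_ne j b with rfl | hjb
          · simp [hji, hbB]
          · simp [Set.indicator_apply, hji, hjb]
      rw [hsum] at hle
      simp only [Finset.sum_sub_distrib, Finset.sum_add_distrib, Finset.sum_ite_eq',
        Finset.mem_univ, if_true] at hle
      linarith
  · rw [← hl i, Finsupp.linearCombination_apply, Finsupp.sum_fintype _ _ (by simp)]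
  · have h0 := hinj (∑ i, a i • l i)
      (Submodule.sum_mem _ fun i _ => Submodule.smul_mem _ _ (hlB i))
      (by simpa [map_sum, hl] using ha)
    simpa using congr($h0 b)

end Basis

/-! ### Evaluation of Laurent polynomials at units -/

section LaurentEval

variable {k : Type u} [Field k] {n : ℕ} {S : Type*} [CommRing S] [Algebra k S]

/-- The evaluation of Laurent polynomials at a tuple of units. -/
noncomputable def laurentEval (k : Type u) [Field k] {n : ℕ} {S : Type*} [CommRing S] [Algebra k S]
    (U : Fin n → Sˣ) : Laurent k n →ₐ[k] S :=
  AddMonoidAlgebra.lift k S (Fin n → ℤ) ((Units.coeHom S).comp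
    { toFun := fun u => ∏ i, U i ^ (u.toAdd i)
      map_one' := by simp
      map_mul' := fun u v => by simp [zpow_add, Finset.prod_mul_distrib] })

theorem laurentEval_single (U : Fin n → Sˣ) (u : Fin n → ℤ) (r : k) :
    laurentEval k U (AddMonoidAlgebra.single u r) = r • ((∏ i, U i ^ u i : Sˣ) : S) := by
  rw [laurentEval, AddMonoidAlgebra.lift_single]; rfl

theorem laurentEval_apply (U : Fin n → Sˣ) (f : Laurent k n) :
    laurentEval k U f = ∑ u ∈ f.coeff.support, f.coeff u • ((∏ i, U i ^ u i : Sˣ) : S) := by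
  rw [laurentEval, AddMonoidAlgebra.lift_apply]; rfl

theorem laurentEval_var (U : Fin n → Sˣ) (i : Fin n) :
    laurentEval k U (AddMonoidAlgebra.single (Pi.single i 1) 1) = U i := by
  rw [laurentEval_single, one_smul, Finset.prod_eq_single i] <;> simp +contextual

theorem laurent_algHom_ext {f g : Laurent k n →ₐ[k] S}
    (h : ∀ i, f (AddMonoidAlgebra.single (Pi.single i 1) 1) =
      g (AddMonoidAlgebra.single (Pi.single i 1) 1)) : f = g := by
  refine AddMonoidAlgebra.algHom_ext ?_ (by ext)
  have hmul : ∀ (φ : Laurent k n →ₐ[k] S) (u v : Fin n → ℤ),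
      φ (AddMonoidAlgebra.single (u + v) 1) =
        φ (AddMonoidAlgebra.single u 1) * φ (AddMonoidAlgebra.single v 1) := fun φ u v => by
    rw [← map_mul, AddMonoidAlgebra.single_mul_single, one_mul]
  have hone : ∀ φ : Laurent k n →ₐ[k] S, φ (AddMonoidAlgebra.single 0 1) = 1 := fun φ => by
    rw [← AddMonoidAlgebra.one_def, map_one]
  -- The exponents on which `f` and `g` agree form a subgroup, by uniqueness of inverses; it
  -- contains the standard basis.
  let H : AddSubgroup (Fin n → ℤ) :=
    { carrier := {u | f (AddMonoidAlgebra.single u 1) = g (AddMonoidAlgebra.single u 1)}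
      zero_mem' := by simp [hone]
      add_mem' := fun {u v} hu hv => by
        simp only [Set.mem_ofPred_eq] at hu hv ⊢
        rw [hmul, hmul, hu, hv]
      neg_mem' := fun {u} hu => by
        simp only [Set.mem_ofPred_eq] at hu ⊢
        have hf : f (AddMonoidAlgebra.single (-u) 1) * f (AddMonoidAlgebra.single u 1) = 1 := by
          rw [← hmul, neg_add_cancel, hone]
        have hg : f (AddMonoidAlgebra.single u 1) * g (AddMonoidAlgebra.single (-u) 1) = 1 := by
          rw [hu, ← hmul, add_neg_cancel, hone]
        exact left_inv_eq_right_inv hf hg }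
  intro u
  change u ∈ H
  rw [← Finset.univ_sum_single u]
  refine H.sum_mem fun i _ => ?_
  have : (Pi.single i (u i) : Fin n → ℤ) = u i • Pi.single i 1 := by
    rw [← Pi.single_smul, smul_eq_mul, mul_one]
  rw [this]
  exact H.zsmul_mem (h i) _

theorem toLaurent_X (i : Fin n) :
    toLaurent k n (MvPolynomial.X i) = AddMonoidAlgebra.single (Pi.single i 1) 1 := by
  simp [toLaurent]

theorem toLaurent_prod_X : toLaurent k n (∏ i, MvPolynomial.X i) = AddMonoidAlgebra.single 1 1 := by
  have : ∀ s : Finset (Fin n), toLaurent k n (∏ i ∈ s, MvPolynomial.X i) =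
      AddMonoidAlgebra.single (∑ i ∈ s, Pi.single i 1) 1 := by
    intro s
    induction s using Finset.induction_on with
    | empty => rw [Finset.prod_empty, map_one, Finset.sum_empty, AddMonoidAlgebra.one_def]
    | insert i s hi ih =>
      rw [Finset.prod_insert hi, map_mul, ih, Finset.sum_insert hi, toLaurent_X,
        AddMonoidAlgebra.single_mul_single, one_mul]
  rw [this, Finset.univ_sum_single (fun _ => (1 : ℤ))]
  rfl

theorem isUnit_single (u : Fin n → ℤ) : IsUnit (AddMonoidAlgebra.single u 1 : Laurent k n) := by
  refine IsUnit.of_mul_eq_one (AddMonoidAlgebra.single (-u) 1) ?_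
  rw [AddMonoidAlgebra.single_mul_single, add_neg_cancel, one_mul, AddMonoidAlgebra.one_def]

end LaurentEval

/-! ### Initial forms as parts of fixed weight -/

section WeightPart

variable {k : Type u} [Field k] {n : ℕ}

open Classical in
/-- The sum of the terms of `w`-weight `W`. -/
noncomputable def weightPart (w : Fin n → ℝ) (W : ℝ) (f : Laurent k n) : Laurent k n :=
  AddMonoidAlgebra.ofCoeff (f.coeff.filter fun u => weight w u = W)

theorem initialForm_eq_weightPart {w : Fin n → ℝ} {W : ℝ} {f : Laurent k n}
    (hW : ∀ u ∈ f.coeff.support, W ≤ weight w u) (hex : ∃ u ∈ f.coeff.support, weight w u = W) :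
    initialForm w f = weightPart w W f := by
  classical
  obtain ⟨v, hv, hvW⟩ := hex
  rw [initialForm, weightPart]
  congr 1
  ext u
  rw [Finsupp.filter_apply, Finsupp.filter_apply]
  by_cases hu : u ∈ f.coeff.support
  · refine if_congr ⟨fun h => le_antisymm (hvW ▸ h v hv) (hW u hu), fun h v hv => ?_⟩ rfl rfl
    rw [h]; exact hW v hv
  · rw [Finsupp.notMem_support_iff.1 hu, ite_self, ite_self]

theorem exists_initialForm_eq_weightPart (w : Fin n → ℝ) (f : Laurent k n) :
    ∃ W, (∀ u ∈ f.coeff.support, W ≤ weight w u) ∧ initialForm w f = weightPart w W f := by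
  rcases f.coeff.support.eq_empty_or_nonempty with h | h
  · refine ⟨0, by simp [h], ?_⟩
    have : f.coeff = 0 := Finsupp.support_eq_empty.1 h
    rw [initialForm, weightPart, this, Finsupp.filter_zero, Finsupp.filter_zero]
  · obtain ⟨v, hv, hmin⟩ := Finset.exists_min_image _ (weight w) h
    exact ⟨weight w v, hmin, initialForm_eq_weightPart hmin ⟨v, hv, rfl⟩⟩

/-- The bound `W` need not be attained: if it is not, the part of weight `W` is zero. This avoids
computing the minimal weight of a relation whose terms may cancel. -/
theorem weightPart_mem_initialIdeal {w : Fin n → ℝ} {W : ℝ} {I : Ideal (Laurent k n)}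
    {f : Laurent k n} (hf : f ∈ I) (hW : ∀ u, f.coeff u ≠ 0 → W ≤ weight w u) :
    weightPart w W f ∈ initialIdeal w I := by
  classical
  by_cases hex : ∃ u ∈ f.coeff.support, weight w u = W
  · rw [← initialForm_eq_weightPart (fun u hu => hW u (Finsupp.mem_support_iff.1 hu)) hex]
    exact Ideal.subset_span ⟨f, hf, rfl⟩
  · have : weightPart w W f = 0 := by
      rw [weightPart, Finsupp.filter_eq_zero_iff _ _ |>.2]
      · rfl
      · intro u hu
        by_contra h
        exact hex ⟨u, Finsupp.mem_support_iff.2 h, hu⟩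
    rw [this]; exact zero_mem _

open Classical in
theorem weightPart_sum_single {ι : Type*} (s : Finset ι) (e : ι → Fin n → ℤ) (a : ι → k)
    (w : Fin n → ℝ) (W : ℝ) :
    weightPart w W (∑ j ∈ s, AddMonoidAlgebra.single (e j) (a j)) =
      ∑ j ∈ s, if weight w (e j) = W then AddMonoidAlgebra.single (e j) (a j) else 0 := by
  rw [weightPart, AddMonoidAlgebra.coeff_sum, Finsupp.filter_sum, AddMonoidAlgebra.ofCoeff_sum]
  refine Finset.sum_congr rfl fun j _ => ?_
  split_ifs with h
  · rw [AddMonoidAlgebra.coeff_single, Finsupp.filter_single_of_pos (fun u => weight w u = W) h]; rfl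
  · rw [AddMonoidAlgebra.coeff_single, Finsupp.filter_single_of_neg (fun u => weight w u = W) h]; rfl

theorem exists_of_coeff_sum_single_ne_zero {ι : Type*} {s : Finset ι} {e : ι → Fin n → ℤ}
    {a : ι → k} {u : Fin n → ℤ}
    (h : (∑ j ∈ s, (AddMonoidAlgebra.single (e j) (a j) : Laurent k n)).coeff u ≠ 0) :
    ∃ j ∈ s, a j ≠ 0 ∧ e j = u := by
  classical
  rw [AddMonoidAlgebra.coeff_sum, Finsupp.finsetSum_apply] at h
  obtain ⟨j, hj, hne⟩ := Finset.exists_ne_zero_of_sum_ne_zero h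
  rw [AddMonoidAlgebra.coeff_single, Finsupp.single_apply] at hne
  refine ⟨j, hj, ?_⟩
  split_ifs at hne with hu
  · exact ⟨hne, hu⟩
  · exact absurd rfl hne

theorem weight_single (w : Fin n → ℝ) (i : Fin n) : weight w (Pi.single i 1) = w i := by
  rw [weight, Finset.sum_eq_single i] <;> simp +contextual

end WeightPart

/-! ### Initial forms as leading coefficients of Hahn series -/

section Hahn

variable {k : Type u} [Field k] {n : ℕ} {S : Type*} [CommRing S]

open HahnSeries

/-- Selects the coefficientwise algebra structure over `HahnSeries.powerSeriesAlgebra`, whose scalar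
multiplication is not reducibly the same. -/
noncomputable instance hahnSeriesAlgebra [Algebra k S] : Algebra k (HahnSeries ℝ S) :=
  HahnSeries.instAlgebra

theorem order_eq_and_leadingCoeff_eq {x : HahnSeries ℝ S} {g : ℝ} (hg : x.coeff g ≠ 0)
    (hlt : ∀ g' < g, x.coeff g' = 0) : x.order = g ∧ x.leadingCoeff = x.coeff g := by
  have hx : x ≠ 0 := by rintro rfl; exact hg rfl
  have : x.order = g := le_antisymm (order_le_of_coeff_ne_zero hg)
    ((le_order_iff_forall hx).2 hlt)
  exact ⟨this, by rw [leadingCoeff_eq, this]⟩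

/-- The order of a Hahn series as a homomorphism on units. -/
noncomputable def unitsOrder (S : Type*) [CommRing S] [IsDomain S] :
    (HahnSeries ℝ S)ˣ →* Multiplicative ℝ where
  toFun x := Multiplicative.ofAdd (x : HahnSeries ℝ S).order
  map_one' := by simp
  map_mul' x y := by rw [Units.val_mul, order_mul x.ne_zero y.ne_zero, ofAdd_add]

/-- The leading coefficient of a Hahn series as a homomorphism. -/
noncomputable def leadingCoeffHom (S : Type*) [CommRing S] [IsDomain S] : HahnSeries ℝ S →* S where
  toFun x := x.leadingCoeff
  map_one' := leadingCoeff_one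
  map_mul' x y := leadingCoeff_mul x y

variable [IsDomain S] {U : Fin n → (HahnSeries ℝ S)ˣ} {V : Fin n → Sˣ} {w : Fin n → ℝ}

theorem order_prod_zpow (hU : ∀ i, (U i : HahnSeries ℝ S).order = w i) (u : Fin n → ℤ) :
    ((∏ i, U i ^ u i : (HahnSeries ℝ S)ˣ) : HahnSeries ℝ S).order = weight w u := by
  have h : unitsOrder S (∏ i, U i ^ u i) = ∏ i, unitsOrder S (U i) ^ u i := by
    simp only [map_prod, map_zpow]
  have h2 := congr(Multiplicative.toAdd $h)
  rw [toAdd_prod] at h2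
  refine h2.trans (Finset.sum_congr rfl fun i _ => ?_)
  rw [toAdd_zpow, zsmul_eq_mul, mul_comm]
  exact congr($(hU i) * _)

theorem leadingCoeff_prod_zpow (hV : ∀ i, (U i : HahnSeries ℝ S).leadingCoeff = V i)
    (u : Fin n → ℤ) :
    ((∏ i, U i ^ u i : (HahnSeries ℝ S)ˣ) : HahnSeries ℝ S).leadingCoeff =
      ((∏ i, V i ^ u i : Sˣ) : S) := by
  have h : Units.map (leadingCoeffHom S) (∏ i, U i ^ u i) =
      ∏ i, Units.map (leadingCoeffHom S) (U i) ^ u i := by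
    simp only [map_prod, map_zpow]
  have hi : ∀ i, Units.map (leadingCoeffHom S) (U i) = V i := fun i => Units.ext (hV i)
  simp only [hi] at h
  exact congr(($h : S))

variable [Algebra k S]

theorem coeff_laurentEval_of_lt (hU : ∀ i, (U i : HahnSeries ℝ S).order = w i) {f : Laurent k n}
    {W : ℝ} (hW : ∀ u ∈ f.coeff.support, W ≤ weight w u) {g : ℝ} (hg : g < W) :
    (laurentEval k U f).coeff g = 0 := by
  rw [laurentEval_apply, coeff_sum]
  refine Finset.sum_eq_zero fun u hu => ?_
  rw [HahnSeries.coeff_smul, coeff_eq_zero_of_lt_order, smul_zero]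
  rw [order_prod_zpow hU]
  exact hg.trans_le (hW u hu)

/-- Each monomial `x^u` becomes a series of order `weight w u`, so only the terms of weight exactly
`W` reach the coefficient at `W`, each through its leading coefficient. -/
theorem coeff_laurentEval (hU : ∀ i, (U i : HahnSeries ℝ S).order = w i)
    (hV : ∀ i, (U i : HahnSeries ℝ S).leadingCoeff = V i) {f : Laurent k n}
    {W : ℝ} (hW : ∀ u ∈ f.coeff.support, W ≤ weight w u) :
    (laurentEval k U f).coeff W = laurentEval k V (weightPart w W f) := by
  classical
  have hf : f = ∑ u ∈ f.coeff.support, AddMonoidAlgebra.single u (f.coeff u) :=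
    (AddMonoidAlgebra.sum_coeff_single f).symm
  conv_rhs => rw [hf]
  rw [weightPart_sum_single, map_sum, laurentEval_apply, coeff_sum]
  refine Finset.sum_congr rfl fun u hu => ?_
  rw [HahnSeries.coeff_smul]
  split_ifs with h
  · rw [laurentEval_single, ← leadingCoeff_prod_zpow hV, leadingCoeff_eq, order_prod_zpow hU, h]
  · rw [map_zero, coeff_eq_zero_of_lt_order, smul_zero]
    rw [order_prod_zpow hU]
    exact lt_of_le_of_ne (hW u hu) (Ne.symm h)

/-- Since `W` is at most the order of a nonzero product, the coefficient at `W` is either the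
product of the leading coefficients or zero. -/
theorem leadingCoeff_dvd_coeff_mul {x y : HahnSeries ℝ S} {W : ℝ} (hx0 : x ≠ 0)
    (hlt : ∀ g < W, (x * y).coeff g = 0) :
    x.leadingCoeff ∣ (x * y).coeff W := by
  by_cases hy : y = 0
  · simp [hy]
  have hxy : x * y ≠ 0 := mul_ne_zero hx0 hy
  rcases ((le_order_iff_forall hxy).2 hlt).eq_or_lt with h | h
  · rw [h, ← leadingCoeff_eq, leadingCoeff_mul]
    exact dvd_mul_right _ _
  · rw [coeff_eq_zero_of_lt_order h]
    exact dvd_zero _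

theorem leadingCoeff_dvd_laurentEval_initialForm
    (hU : ∀ i, (U i : HahnSeries ℝ S).order = w i)
    (hV : ∀ i, (U i : HahnSeries ℝ S).leadingCoeff = V i) {x : HahnSeries ℝ S} (hx0 : x ≠ 0)
    {f : Laurent k n} (hf : x ∣ laurentEval k U f) :
    x.leadingCoeff ∣ laurentEval k V (initialForm w f) := by
  obtain ⟨W, hW, hin⟩ := exists_initialForm_eq_weightPart w f
  obtain ⟨y, hy⟩ := hf
  rw [hin, ← coeff_laurentEval hU hV hW, hy]
  refine leadingCoeff_dvd_coeff_mul hx0 fun g hg => ?_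
  rw [← hy]
  exact coeff_laurentEval_of_lt hU hW hg

end Hahn

/-! ### Leading forms of the coordinate functions -/

section LeadForm

open MvPolynomial

variable {k : Type u} [Field k] {n : ℕ}

/-- The part of the linear form `∑ b, c i b * x b` supported on the variables of weight `w i`. -/
noncomputable def leadForm (c : Fin n → Fin n → k) (w : Fin n → ℝ) (i : Fin n) :
    MvPolynomial (Fin n) k :=
  ∑ b, if w b = w i then C (c i b) * X b else 0

theorem isHomogeneous_leadForm (c : Fin n → Fin n → k) (w : Fin n → ℝ) (i : Fin n) :
    (leadForm c w i).IsHomogeneous 1 := by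
  refine IsHomogeneous.sum _ _ _ fun b _ => ?_
  split_ifs
  · simpa using (isHomogeneous_C (Fin n) (c i b)).mul (isHomogeneous_X k b)
  · exact isHomogeneous_zero _ _ _

theorem leadForm_eq_X {c : Fin n → Fin n → k} {w : Fin n → ℝ} {b : Fin n}
    (hb : c b = Pi.single b 1) : leadForm c w b = X b := by
  rw [leadForm, Finset.sum_eq_single b]
  · simp [hb]
  · intro j _ hj
    simp [hb, hj]
  · simp

/-- Evaluation at the basis vector `Pi.single b' 1` kills multiples of `X b` and reads off `c j b'`.
-/
theorem coeff_eq_zero_of_X_dvd_leadForm {c : Fin n → Fin n → k} {w : Fin n → ℝ} {b j : Fin n}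
    (hdvd : X b ∣ leadForm c w j) {b' : Fin n} (hb' : b' ≠ b) (hw : w b' = w j) :
    c j b' = 0 := by
  obtain ⟨q, hq⟩ := hdvd
  have h := congr(eval (Pi.single b' 1) $hq)
  rw [map_mul, eval_X, Pi.single_eq_of_ne hb'.symm, zero_mul, leadForm, map_sum,
    Finset.sum_eq_single b'] at h
  · simpa [hw] using h
  · intro j' _ hj'
    split_ifs <;> simp [hj']
  · simp

theorem exists_of_leadForm_ne_zero {c : Fin n → Fin n → k} {w : Fin n → ℝ} {j : Fin n}
    (h : leadForm c w j ≠ 0) : ∃ b, w b = w j ∧ c j b ≠ 0 := by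
  obtain ⟨b, -, hb⟩ := Finset.exists_ne_zero_of_sum_ne_zero h
  refine ⟨b, ?_⟩
  split_ifs at hb with hw
  · exact ⟨hw, fun h0 => hb (by rw [h0, C_0, zero_mul])⟩
  · exact absurd rfl hb

theorem irreducible_prod_leadForm_sub_one {c : Fin n → Fin n → k} {w : Fin n → ℝ} {b : Fin n}
    (hb : c b = Pi.single b 1) (hndvd : ∀ j, j ≠ b → ¬ X b ∣ leadForm c w j) :
    Irreducible (∏ i, leadForm c w i - 1) := by
  have hprod : ∏ i, leadForm c w i = X b * ∏ i ∈ Finset.univ.erase b, leadForm c w i := by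
    rw [← Finset.mul_prod_erase _ _ (Finset.mem_univ b), leadForm_eq_X hb]
  have hhom : (∏ i, leadForm c w i).IsHomogeneous (∑ _i : Fin n, 1) :=
    IsHomogeneous.prod _ _ _ fun i _ => isHomogeneous_leadForm c w i
  rw [hprod] at hhom ⊢
  refine irreducible_X_mul_sub_one (fun hd => ?_) (by simpa using (Fin.pos b).ne') hhom
  obtain ⟨j, hj, hdj⟩ := (Prime.dvd_finsetProd_iff X_prime _).1 hd
  exact hndvd j (Finset.ne_of_mem_erase hj) hdj

end LeadForm

/-! ### The initial ideal of the Milnor fiber -/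

section MilnorFiber

variable {k : Type u} [Field k] {n : ℕ} {A : Submodule k (Fin n → k)} {w : Fin n → ℝ}

theorem sum_smul_coord_eq_zero_iff {a : Fin n → k} :
    ∑ i, a i • coord A i = 0 ↔ ∀ v ∈ A, ∑ i, a i * v i = 0 := by
  constructor
  · intro h v hv
    simpa [coord] using congr($h ⟨v, hv⟩)
  · intro h
    ext v
    simpa [coord] using h v v.2

theorem sum_single_mem_milnorTorusIdeal {a : Fin n → k} (ha : ∑ i, a i • coord A i = 0) :
    ∑ i, AddMonoidAlgebra.single (Pi.single i 1) (a i) ∈ milnorTorusIdeal A := by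
  have h : ∑ i, MvPolynomial.C (a i) * MvPolynomial.X i ∈ milnorIdeal A :=
    Ideal.mem_sup_left (Ideal.subset_span ⟨a, sum_smul_coord_eq_zero_iff.1 ha, rfl⟩)
  rw [milnorTorusIdeal]
  convert Ideal.mem_map_of_mem (toLaurent k n) h
  rw [map_sum]
  refine Finset.sum_congr rfl fun i _ => ?_
  rw [← MvPolynomial.algebraMap_eq, ← Algebra.smul_def, map_smul, toLaurent_X,
    AddMonoidAlgebra.smul_single, smul_eq_mul, mul_one]

theorem prod_sub_one_mem_milnorTorusIdeal :
    AddMonoidAlgebra.single 1 1 - 1 ∈ milnorTorusIdeal A := by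
  rw [← toLaurent_prod_X, ← map_one (toLaurent k n), ← map_sub]
  exact Ideal.mem_map_of_mem _ (Ideal.mem_sup_right (Ideal.subset_span rfl))

/-- The initial forms of the coordinate relations lie in the initial ideal. -/
theorem toLaurent_X_sub_leadForm_mem {c : Fin n → Fin n → k} {i : Fin n}
    (hle : ∀ b, c i b ≠ 0 → w i ≤ w b) (hc : coord A i = ∑ b, c i b • coord A b) :
    toLaurent k n (MvPolynomial.X i - leadForm c w i) ∈ initialIdeal w (milnorTorusIdeal A) := by
  classical
  have ha : ∑ j, (Pi.single i 1 - c i : Fin n → k) j • coord A j = 0 := by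
    have hi : ∑ j, (Pi.single i 1 : Fin n → k) j • coord A j = coord A i := by
      rw [Finset.sum_eq_single i] <;> simp +contextual
    rw [← sub_eq_zero.2 (hi.trans hc), ← Finset.sum_sub_distrib]
    refine Finset.sum_congr rfl fun j _ => LinearMap.ext fun v => ?_
    simp [sub_mul]
  -- All terms of `x_i - ∑ c i b x_b` have weight at least `w i`; its part of weight `w i` is the
  -- required element.
  have hmem := weightPart_mem_initialIdeal (w := w) (W := w i)
    (sum_single_mem_milnorTorusIdeal ha) fun u hu => by
      obtain ⟨j, -, hj, rfl⟩ := exists_of_coeff_sum_single_ne_zero hu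
      rw [weight_single]
      rcases eq_or_ne j i with rfl | hji
      · exact le_rfl
      · refine hle j fun h0 => hj ?_
        simp [hji, h0]
  rw [weightPart_sum_single] at hmem
  convert hmem using 1
  have hX : toLaurent k n (MvPolynomial.X i) = ∑ j, if w j = w i then
      AddMonoidAlgebra.single (Pi.single j 1) ((Pi.single i 1 : Fin n → k) j) else 0 := by
    rw [toLaurent_X, Finset.sum_eq_single i] <;> simp +contextual
  rw [map_sub, hX, leadForm, map_sum, ← Finset.sum_sub_distrib]
  refine Finset.sum_congr rfl fun j _ => ?_
  rw [weight_single]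
  split_ifs
  · rw [← MvPolynomial.algebraMap_eq, ← Algebra.smul_def, map_smul, toLaurent_X,
      AddMonoidAlgebra.smul_single, smul_eq_mul, mul_one, Pi.sub_apply, AddMonoidAlgebra.single_sub]
  · rw [map_zero, sub_zero]

theorem weight_one (w : Fin n → ℝ) : weight w 1 = ∑ i, w i := by
  simp [weight]

theorem weight_zero (w : Fin n → ℝ) : weight w 0 = 0 := by
  simp [weight]

/-- Puts the binomial in the shape to which `weightPart_sum_single` applies. -/
theorem prod_sub_one_eq_sum :
    (AddMonoidAlgebra.single 1 1 - 1 : Laurent k n) =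
      ∑ j : Bool, AddMonoidAlgebra.single (bif j then 1 else 0) (bif j then 1 else -1) := by
  rw [Fintype.sum_bool, AddMonoidAlgebra.one_def, cond_true, cond_true, cond_false, cond_false,
    AddMonoidAlgebra.single_neg, sub_eq_add_neg]

open Classical in
theorem weightPart_prod_sub_one_mem {W : ℝ} (hW1 : W ≤ ∑ i, w i) (hW0 : W ≤ 0) :
    (if ∑ i, w i = W then AddMonoidAlgebra.single 1 1 else 0) -
      (if 0 = W then 1 else 0) ∈ initialIdeal w (milnorTorusIdeal A) := by
  have hmem := weightPart_mem_initialIdeal (w := w) (W := W)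
    (prod_sub_one_eq_sum (k := k) ▸ prod_sub_one_mem_milnorTorusIdeal (A := A)) fun u hu => by
      obtain ⟨j, -, -, rfl⟩ := exists_of_coeff_sum_single_ne_zero hu
      cases j
      · rw [cond_false, weight_zero]; exact hW0
      · rw [cond_true, weight_one]; exact hW1
  rw [weightPart_sum_single, Fintype.sum_bool] at hmem
  convert hmem using 1
  rw [cond_true, cond_true, cond_false, cond_false, weight_one, weight_zero,
    AddMonoidAlgebra.single_neg, sub_eq_add_neg, AddMonoidAlgebra.one_def]
  split_ifs <;> simp

theorem initialIdeal_eq_top_of_sum_ne_zero (h : ∑ i, w i ≠ 0) :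
    initialIdeal w (milnorTorusIdeal A) = ⊤ := by
  rcases lt_or_gt_of_ne h with h' | h'
  · have := weightPart_prod_sub_one_mem (A := A) le_rfl h'.le
    rw [if_pos rfl, if_neg h.symm, sub_zero] at this
    exact Ideal.eq_top_of_isUnit_mem _ this (isUnit_single 1)
  · have := weightPart_prod_sub_one_mem (A := A) h'.le le_rfl
    rw [if_neg h, if_pos rfl, zero_sub] at this
    exact Ideal.eq_top_of_isUnit_mem _ this isUnit_one.neg

theorem prod_sub_one_mem_initialIdeal (h : ∑ i, w i = 0) :
    AddMonoidAlgebra.single 1 1 - 1 ∈ initialIdeal w (milnorTorusIdeal A) := by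
  have := weightPart_prod_sub_one_mem (A := A) h.ge le_rfl
  rwa [if_pos h, if_pos rfl] at this

/-- If `c` expresses the coordinates of `A` through a base of maximal weight and no leading form
vanishes, the initial ideal is cut out by the single equation `∏ leadForm = 1`. -/
theorem isPrime_initialIdeal {c : Fin n → Fin n → k} (hle : ∀ i b, c i b ≠ 0 → w i ≤ w b)
    (hc : ∀ i, coord A i = ∑ b, c i b • coord A b)
    (hrel : ∀ a : Fin n → k, ∑ i, a i • coord A i = 0 → ∀ b, ∑ i, a i * c i b = 0)
    (hw : ∑ i, w i = 0) (hne : ∀ i, leadForm c w i ≠ 0)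
    (hirr : Irreducible (∏ i, leadForm c w i - 1)) :
    (initialIdeal w (milnorTorusIdeal A)).IsPrime := by
  classical
  set h := ∏ i, leadForm c w i with hh
  have hh0 : h ≠ 0 := Finset.prod_ne_zero_iff.2 fun i _ => hne i
  -- Variables outside the base may stay free in `R`. This is harmless, since the initial ideal is
  -- only to be a preimage of an ideal of `R`.
  let R := Localization.Away h
  let ι : MvPolynomial (Fin n) k →ₐ[k] R := IsScalarTower.toAlgHom k _ R
  have hpow : Submonoid.powers h ≤ nonZeroDivisors (MvPolynomial (Fin n) k) :=
    powers_le_nonZeroDivisors_of_noZeroDivisors hh0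
  have : IsDomain R := IsLocalization.isDomain_localization hpow
  have hιinj : Function.Injective ι := IsLocalization.injective R hpow
  have hι0 : ∀ {p}, p ≠ 0 → ι p ≠ 0 := fun hp => (map_ne_zero_iff ι hιinj).2 hp
  have hunit : ∀ i, IsUnit (ι (leadForm c w i)) := fun i =>
    isUnit_of_dvd_unit (map_dvd ι (Finset.dvd_prod_of_mem _ (Finset.mem_univ i)))
      (IsLocalization.Away.algebraMap_isUnit h)
  choose V hV using hunit
  -- the deformation of the coordinate functions to their leading forms
  let θ : Fin n → HahnSeries ℝ R := fun i =>
    ∑ b, HahnSeries.single (w b) (ι (MvPolynomial.C (c i b) * MvPolynomial.X b))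
  have hθcoeff : ∀ i, (θ i).coeff (w i) = ι (leadForm c w i) := fun i => by
    rw [HahnSeries.coeff_sum, leadForm, map_sum]
    refine Finset.sum_congr rfl fun b _ => ?_
    rw [HahnSeries.coeff_single, apply_ite ι, map_zero]
    simp only [eq_comm]
  have hθlt : ∀ i, ∀ g < w i, (θ i).coeff g = 0 := fun i g hg => by
    rw [HahnSeries.coeff_sum]
    refine Finset.sum_eq_zero fun b _ => ?_
    by_cases hcb : c i b = 0
    · simp [hcb]
    · exact HahnSeries.coeff_single_of_ne (hg.trans_le (hle i b hcb)).ne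
  have hθ : ∀ i, (θ i).order = w i ∧ (θ i).leadingCoeff = V i := fun i => by
    have := order_eq_and_leadingCoeff_eq (x := θ i) (g := w i)
      (by rw [hθcoeff]; exact hι0 (hne i)) (hθlt i)
    rwa [hθcoeff, ← hV] at this
  have hθunit : ∀ i, IsUnit (θ i) := fun i => by
    rw [HahnSeries.isUnit_iff, (hθ i).2]; exact (V i).isUnit
  choose U hU using hθunit
  have hUord : ∀ i, (U i : HahnSeries ℝ R).order = w i := fun i => by rw [hU]; exact (hθ i).1
  have hUlc : ∀ i, (U i : HahnSeries ℝ R).leadingCoeff = V i := fun i => by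
    rw [hU]; exact (hθ i).2
  -- the equation of the deformed hypersurface
  let x : HahnSeries ℝ R := laurentEval k U (AddMonoidAlgebra.single 1 1) - 1
  have hPord := order_prod_zpow hUord 1
  have hPlc := leadingCoeff_prod_zpow hUlc 1
  have hx1 : laurentEval k U (AddMonoidAlgebra.single 1 1) =
      ((∏ i, U i ^ (1 : Fin n → ℤ) i : (HahnSeries ℝ R)ˣ) : HahnSeries ℝ R) := by
    rw [laurentEval_single, one_smul]
  have hVprod : ((∏ i, V i ^ (1 : Fin n → ℤ) i : Rˣ) : R) = ι h := by
    simp [hh, hV]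
  rw [← hx1, weight_one, hw] at hPord
  rw [← hx1, hVprod] at hPlc
  have hxc : x.coeff 0 = ι (h - 1) := by
    rw [HahnSeries.leadingCoeff_eq, hPord] at hPlc
    rw [HahnSeries.coeff_sub, hPlc, map_sub, map_one, HahnSeries.coeff_one, if_pos rfl]
  have hxlt : ∀ g < 0, x.coeff g = 0 := fun g hg => by
    rw [HahnSeries.coeff_sub, HahnSeries.coeff_eq_zero_of_lt_order (by rwa [hPord]),
      HahnSeries.coeff_one, if_neg hg.ne, sub_zero]
  have hxc0 : x.coeff 0 ≠ 0 := by rw [hxc]; exact hι0 hirr.ne_zero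
  have hx0 : x ≠ 0 := fun h0 => hxc0 (by rw [h0]; rfl)
  have hxlc : x.leadingCoeff = ι (h - 1) := by
    rw [(order_eq_and_leadingCoeff_eq hxc0 hxlt).2, hxc]
  -- The series `θ i` satisfy every linear relation of `A`, by `hrel` applied to each `b`
  -- separately, so `F` imposes only the equation `x = 0`.
  have hdvd : milnorTorusIdeal A ≤ (Ideal.span {x}).comap (laurentEval k U) := by
    rw [milnorTorusIdeal, Ideal.map_le_iff_le_comap, milnorIdeal, sup_le_iff, linearIdeal,
      Ideal.span_le, Ideal.span_le]
    constructor
    · rintro _ ⟨a, ha, rfl⟩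
      have hzero : laurentEval k U (toLaurent k n
          (∑ i, MvPolynomial.C (a i) * MvPolynomial.X i)) = 0 := by
        simp only [map_sum, ← MvPolynomial.algebraMap_eq, ← Algebra.smul_def, map_smul,
          toLaurent_X, laurentEval_var, hU, θ, Finset.smul_sum]
        rw [Finset.sum_comm]
        refine Finset.sum_eq_zero fun b _ => ?_
        have hb := hrel a (sum_smul_coord_eq_zero_iff.2 ha) b
        have hs : ∀ i, a i • HahnSeries.single (w b) (c i b • ι (MvPolynomial.X b)) =
            HahnSeries.single (w b) ((a i * c i b) • ι (MvPolynomial.X b)) := fun i => by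
          rw [mul_smul]
          ext g
          simp only [HahnSeries.coeff_smul, HahnSeries.coeff_single, smul_ite, smul_zero]
        rw [Finset.sum_congr rfl fun i _ => hs i]
        ext g
        simp only [HahnSeries.coeff_sum, HahnSeries.coeff_single]
        split_ifs
        · rw [← Finset.sum_smul, hb, zero_smul, HahnSeries.coeff_zero]
        · rw [Finset.sum_const_zero, HahnSeries.coeff_zero]
      rw [SetLike.mem_coe, Ideal.mem_comap, Ideal.mem_comap, hzero]
      exact zero_mem _
    · rintro _ rfl
      rw [SetLike.mem_coe, Ideal.mem_comap, Ideal.mem_comap, map_sub, toLaurent_prod_X, map_one, map_sub, map_one]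
      exact Ideal.mem_span_singleton_self x
  have hsub : initialIdeal w (milnorTorusIdeal A) ≤
      (Ideal.span {ι (h - 1)}).comap (laurentEval k V) := by
    rw [initialIdeal, Ideal.span_le]
    rintro _ ⟨f, hf, rfl⟩
    rw [SetLike.mem_coe, Ideal.mem_comap, Ideal.mem_span_singleton, ← hxlc]
    exact leadingCoeff_dvd_laurentEval_initialForm hUord hUlc hx0
      (Ideal.mem_span_singleton.1 (hdvd hf))
  -- the inverse of the induced map on quotients
  set Q := initialIdeal w (milnorTorusIdeal A) with hQ
  let mk : Laurent k n →ₐ[k] Laurent k n ⧸ Q := Ideal.Quotient.mkₐ k Q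
  let F : MvPolynomial (Fin n) k →ₐ[k] Laurent k n ⧸ Q := mk.comp (toLaurent k n)
  have hFlead : ∀ i, F (leadForm c w i) = F (MvPolynomial.X i) := fun i =>
    (Ideal.Quotient.eq.2 (by
      rw [← map_sub]; exact toLaurent_X_sub_leadForm_mem (hle i) (hc i))).symm
  have hFh : F h = 1 := by
    rw [hh, map_prod, Finset.prod_congr rfl fun i _ => hFlead i, ← map_prod]
    change mk (toLaurent k n _) = 1
    rw [toLaurent_prod_X, ← map_one mk]
    exact Ideal.Quotient.eq.2 (prod_sub_one_mem_initialIdeal hw)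
  have hFunit : ∀ y : Submonoid.powers h, IsUnit (F y) := by
    rintro ⟨_, m, rfl⟩
    simp [hFh]
  -- Sending each variable to its class is well defined on `R` because `h` maps to `1`. Modulo `Q`
  -- each `ℓ_i` equals `x_i`, so `G` undoes `laurentEval k V`; as `G` kills `h - 1`, the reverse
  -- inclusion follows.
  let G : R →ₐ[k] Laurent k n ⧸ Q := IsLocalization.liftAlgHom (M := Submonoid.powers h) hFunit
  have hG : ∀ p, G (ι p) = F p := fun p => IsLocalization.lift_eq _ p
  have hcomp : G.comp (laurentEval k V) = mk := laurent_algHom_ext fun i => by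
    rw [AlgHom.comp_apply, laurentEval_var, hV, hG, hFlead, ← toLaurent_X]
    rfl
  have hsup : (Ideal.span {ι (h - 1)}).comap (laurentEval k V) ≤ Q := by
    intro p hp
    obtain ⟨q, hq⟩ := Ideal.mem_span_singleton.1 (Ideal.mem_comap.1 hp)
    have h1 : mk p = 0 := by
      rw [← hcomp, AlgHom.comp_apply]
      have : laurentEval k V p = ι (h - 1) * q := hq
      rw [this, map_mul, hG, map_sub, hFh, map_one, sub_self, zero_mul]
    exact Ideal.Quotient.eq_zero_iff_mem.1 h1
  have hprime : (Ideal.span {h - 1}).IsPrime :=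
    (Ideal.span_singleton_prime hirr.ne_zero).2 hirr.prime
  -- Modulo `h - 1` every power of `h` is `1`, so the prime `(h - 1)` survives the localization.
  have hdisj : Disjoint (Submonoid.powers h : Set (MvPolynomial (Fin n) k))
      (Ideal.span {h - 1} : Ideal _) := by
    rw [Set.disjoint_left]
    rintro _ ⟨m, rfl⟩ hm
    have hhm : h ∈ Ideal.span {h - 1} := hprime.mem_of_pow_mem m hm
    apply hprime.ne_top
    rw [Ideal.eq_top_iff_one]
    simpa using sub_mem hhm (Ideal.mem_span_singleton_self (h - 1))
  have hRprime := IsLocalization.isPrime_of_isPrime_disjoint (Submonoid.powers h) R _ hprime hdisj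
  rw [Ideal.map_span, Set.image_singleton] at hRprime
  rw [le_antisymm hsub hsup]
  exact hRprime.comap _

end MilnorFiber

/-! ### Proportional coordinates are parallel -/

section Parallel

variable {k : Type u} [Field k] {n : ℕ} {M : Matroid (Fin n)} {A : Submodule k (Fin n → k)}

theorem coord_ne_zero (hE : M.E = Set.univ) (hloop : M.Loopless)
    (hA : ∀ I : Set (Fin n), M.Indep I ↔ LinearIndepOn k (coord A) I) (i : Fin n) :
    coord A i ≠ 0 := by
  rw [← linearIndepOn_singleton_iff k, ← hA]
  exact (M.isNonloop_of_loopless (hE ▸ Set.mem_univ i)).indep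

theorem parallel_of_coord_eq_smul (hE : M.E = Set.univ) (hloop : M.Loopless)
    (hA : ∀ I : Set (Fin n), M.Indep I ↔ LinearIndepOn k (coord A) I) {i j : Fin n} {r : k}
    (h : coord A j = r • coord A i) : Parallel M i j := by
  classical
  have hnl : ∀ i, M.IsNonloop i := fun i => M.isNonloop_of_loopless (hE ▸ Set.mem_univ i)
  refine ⟨hnl i, or_iff_not_imp_left.2 fun hij => ?_⟩
  rw [Matroid.isCircuit_iff_dep_forall_sdiff_singleton_indep]
  refine ⟨⟨fun hind => ?_, hE ▸ Set.subset_univ _⟩, fun e he => ?_⟩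
  · rw [hA, linearIndepOn_pair_iff _ hij (coord_ne_zero hE hloop hA i)] at hind
    exact hind r h.symm
  · rcases he with rfl | rfl
    · exact (hnl j).indep.subset fun x hx => hx.1.resolve_left hx.2
    · exact (hnl i).indep.subset fun x hx => hx.1.resolve_right hx.2

end Parallel

theorem isPrime_initialIdeal_or_eq_top {k : Type u} [Field k] {n : ℕ} (hn : 0 < n)
    {M : Matroid (Fin n)} (hE : M.E = Set.univ) (hloop : M.Loopless)
    (hpar : ∀ i j : Fin n, Parallel M i j → i = j) {A : Submodule k (Fin n → k)}
    (hA : ∀ I : Set (Fin n), M.Indep I ↔ LinearIndepOn k (coord A) I) (w : Fin n → ℝ) :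
    initialIdeal w (milnorTorusIdeal A) = ⊤ ∨ (initialIdeal w (milnorTorusIdeal A)).IsPrime := by
  by_cases hw : ∑ i, w i = 0
  swap
  · exact Or.inl (initialIdeal_eq_top_of_sum_ne_zero hw)
  obtain ⟨B, c, hB, hcB, hc, hrel⟩ := exists_maxWeight_base hA w
  by_cases hne : ∀ i, leadForm c w i ≠ 0
  swap
  · push Not at hne
    obtain ⟨i, hi⟩ := hne
    have hmem := toLaurent_X_sub_leadForm_mem (fun b hb => (hcB i b hb).2) (hc i)
    rw [hi, sub_zero, toLaurent_X] at hmem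
    exact Or.inl (Ideal.eq_top_of_isUnit_mem _ hmem (isUnit_single _))
  right
  refine isPrime_initialIdeal (fun i b hb => (hcB i b hb).2) hc hrel hw hne ?_
  have : Nonempty (Fin n) := ⟨⟨0, hn⟩⟩
  obtain ⟨i₀, hi₀⟩ := Finite.exists_max w
  -- A nonzero coordinate of maximal weight involves some base element, whose weight is at least as
  -- large and hence also maximal.
  obtain ⟨b, hb⟩ : ∃ b, c i₀ b ≠ 0 := by
    by_contra! h
    exact coord_ne_zero hE hloop hA i₀ (by rw [hc i₀]; simp [h])
  have hbmax : ∀ i, w i ≤ w b := fun i => (hi₀ i).trans (hcB i₀ b hb).2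
  refine irreducible_prod_leadForm_sub_one (hB b (hcB i₀ b hb).1) fun j hjb hdvd => hjb ?_
  have hzero : ∀ b', b' ≠ b → w b' = w j → c j b' = 0 := fun b' =>
    coeff_eq_zero_of_X_dvd_leadForm hdvd
  obtain ⟨b', hb'w, hb'⟩ := exists_of_leadForm_ne_zero (hne j)
  obtain rfl : b' = b := by
    by_contra h
    exact hb' (hzero b' h hb'w)
  refine (hpar b' j (parallel_of_coord_eq_smul hE hloop hA (r := c j b') ?_)).symm
  -- Here `w j` is the maximal weight, so every base element in the expansion of `coord A j` already
  -- occurs in its leading form, which is a multiple of the single variable `X b'`.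
  rw [hc j, Finset.sum_eq_single b']
  · intro b'' _ hb''
    by_contra hcon
    have h0 : c j b'' ≠ 0 := fun h0 => hcon (by rw [h0, zero_smul])
    exact h0 (hzero b'' hb'' (le_antisymm ((hbmax b'').trans hb'w.le) (hcB j b'' h0).2))
  · simp

end MilnorArrangement

theorem mainTheorem7 {k : Type u} [Field k] [IsAlgClosed k] {d n : ℕ} (hd : 0 < d) (hn : 0 < n)
    (M : Matroid (Fin n)) (hE : M.E = Set.univ) (hrank : M.eRank = d) (hloop : M.Loopless)
    (hpar : ∀ i j : Fin n, MilnorArrangement.Parallel M i j → i = j)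
    (A : Submodule k (Fin n → k)) (hA : A ∈ MilnorArrangement.GrMatroid k d M)
    (w : Fin n → ℝ) :
    IsEmpty (MilnorArrangement.initialDegeneration w (MilnorArrangement.milnorTorusIdeal A)) ∨
      IrreducibleSpace
        (MilnorArrangement.initialDegeneration w (MilnorArrangement.milnorTorusIdeal A)) := by
  rcases MilnorArrangement.isPrime_initialIdeal_or_eq_top hn hE hloop hpar hA.2 w with h | h
  · left
    have := Ideal.Quotient.subsingleton_iff.2 h
    exact PrimeSpectrum.isEmpty_iff_subsingleton.2 this
  · right
    have := (Ideal.Quotient.isDomain_iff_prime _).2 h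
    rw [MilnorArrangement.initialDegeneration]
    infer_instance
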